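/- Work over $\mathbb{C}$, and let $\mathbb{P}V$ denote the projective space of lines in a vector space $V$. Let $U, W$ be finite-dimensional complex vector spaces and $\sigma : \mathrm{Sym}^2 U \to W$ a surjective linear map. Let $W^* \subset \mathrm{Sym}^2 U^*$ be the linear system of quadrics $u \mapsto \ell(\sigma(u,u))$, where $\ell$ runs over the linear forms on $W$. Let $B(\sigma) \subset \mathbb{P}U$ be the closed subscheme defined by these quadrics, i.e. the scheme-theoretic base locus of the rational map $\psi^o : \mathbb{P}U \dashrightarrow \mathbb{P}W$, $[u] \mapsto [\sigma(u,u)]$. Let $Y(\sigma) \subset \mathbb{P}W$ be the proper image of $\psi^o$, i.e. the Zariski closure, with its reduced structure, of the image of the open set where $\sigma(u,u) \neq 0$. Put $T = \mathbb{C}$ and let $Z(\sigma) \subset \mathbb{P}(T \oplus U \oplus W)$ be the proper image of the rational map $\phi^o : \mathbb{P}(T \oplus U) \dashrightarrow \mathbb{P}(T \oplus U \oplus W)$, $[t:u] \mapsto [t^2 : tu : \sigma(u,u)]$, defined in the same way. Suppose that $\sigma$ is a special system of quadrics, that is, the scheme $B(\sigma)$ is irreducible and nonsingular and $Z(\sigma)$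 is nonsingular; then $S = B(\sigma)$ is called a special quadratic manifold. Then the variety $Y(\sigma)$ is nonsingular. -/

import Mathlib

open CategoryTheory AlgebraicGeometry
open scoped DirectSum TensorProduct

noncomputable section

namespace QuadricSystem

/-! ### Homogeneous coordinate rings and projective schemes -/

/-- The homogeneous coordinate ring `Sym (V^*)` of the projective space `ℙ V` of lines in `V`. -/
abbrev CoordRing (V : Type*) [AddCommGroup V] [Module ℂ V] : Type _ :=
  SymmetricAlgebra ℂ (Module.Dual ℂ V)

/-- The homogeneous forms of degree `n` on `V`: the linear span of the products of `n` linear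
forms, that is `H^0(ℙ V, O(n))`. -/
def forms (V : Type*) [AddCommGroup V] [Module ℂ V] (n : ℕ) : Submodule ℂ (CoordRing V) :=
  LinearMap.range (SymmetricAlgebra.ι ℂ (Module.Dual ℂ V)) ^ n

/-- The value of a polynomial at a vector: the algebra homomorphism `Sym (V^*) → ℂ` that sends a
linear form `l` to `l v`. -/
def evalAt {V : Type*} [AddCommGroup V] [Module ℂ V] (v : V) : CoordRing V →ₐ[ℂ] ℂ :=
  SymmetricAlgebra.lift (Module.Dual.eval ℂ V v)

section Grading

variable (V : Type*) [AddCommGroup V] [Module ℂ V]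

instance forms_gradedMonoid : SetLike.GradedMonoid (forms V) where
  one_mem := by
    change (1 : CoordRing V) ∈ LinearMap.range (SymmetricAlgebra.ι ℂ (Module.Dual ℂ V)) ^ 0
    rw [pow_zero]
    exact Submodule.one_le.mp le_rfl
  mul_mem i j a b ha hb := by
    change a * b ∈ LinearMap.range (SymmetricAlgebra.ι ℂ (Module.Dual ℂ V)) ^ (i + j)
    rw [pow_add]
    exact Submodule.mul_mem_mul ha hb

lemma ι_mem_forms (l : Module.Dual ℂ V) :
    SymmetricAlgebra.ι ℂ (Module.Dual ℂ V) l ∈ forms V 1 := by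
  change _ ∈ LinearMap.range (SymmetricAlgebra.ι ℂ (Module.Dual ℂ V)) ^ 1
  rw [pow_one]
  exact LinearMap.mem_range_self _ l

/-- Auxiliary map for the grading: a linear form, placed in degree one. -/
def gradedι : Module.Dual ℂ V →ₗ[ℂ] ⨁ i : ℕ, forms V i :=
  DirectSum.lof ℂ ℕ (fun i => forms V i) 1 ∘ₗ
    (SymmetricAlgebra.ι ℂ (Module.Dual ℂ V)).codRestrict _ (ι_mem_forms V)

/-- The coordinate ring is graded by the degree of forms. -/
instance formsGradedAlgebra : GradedAlgebra (forms V) :=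
  GradedAlgebra.ofAlgHom _ (SymmetricAlgebra.lift (gradedι V))
    (by
      ext m
      simp [gradedι, DirectSum.lof_eq_of, DirectSum.coeAlgHom_of])
    fun i x => by
      obtain ⟨x, hx⟩ := x
      dsimp only [Subtype.coe_mk]
      induction hx using Submodule.pow_induction_on_left' with
      | algebraMap r =>
        rw [AlgHom.commutes, DirectSum.algebraMap_apply]; rfl
      | add x y i hx hy ihx ihy =>
        rw [map_add, ihx, ihy, ← map_add]
        rfl
      | mem_mul m hm i x hx ih =>
        obtain ⟨l, rfl⟩ := hm
        rw [map_mul, ih, SymmetricAlgebra.lift_ι_apply]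
        change DirectSum.of (fun i => forms V i) 1 _ * DirectSum.of (fun i => forms V i) i _ = _
        rw [DirectSum.of_mul_of]
        exact DirectSum.of_eq_of_gradedMonoid_eq (Sigma.subtype_ext (add_comm _ _) rfl)

end Grading

section Quotient

variable {V : Type*} [AddCommGroup V] [Module ℂ V] (I : HomogeneousIdeal (forms V))

/-- The degree `n` part of the graded ring `Sym (V^*) / I`. -/
def quotForms (n : ℕ) : Submodule ℂ (CoordRing V ⧸ I.toIdeal) :=
  (forms V n).map (Ideal.Quotient.mkₐ ℂ I.toIdeal).toLinearMap

instance quotForms_gradedMonoid : SetLike.GradedMonoid (quotForms I) where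
  one_mem := ⟨1, SetLike.GradedOne.one_mem, by simp⟩
  mul_mem i j a b := by
    rintro ⟨a, ha, rfl⟩ ⟨b, hb, rfl⟩
    exact ⟨a * b, SetLike.GradedMul.mul_mem ha hb, by simp⟩

/-- Auxiliary map for the grading: the class of a form, placed in its degree. -/
def quotComponent (n : ℕ) : forms V n →ₗ[ℂ] quotForms I n :=
  (Ideal.Quotient.mkₐ ℂ I.toIdeal).toLinearMap.restrict fun a ha => ⟨a, ha, rfl⟩

/-- Auxiliary map for the grading: decompose a polynomial and reduce its components modulo `I`. -/
def quotDecomposeAux : CoordRing V →ₐ[ℂ] ⨁ n, quotForms I n :=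
  (DirectSum.toAlgebra ℂ (fun n => forms V n)
    (fun n => DirectSum.lof ℂ ℕ (fun n => quotForms I n) n ∘ₗ quotComponent I n)
    (by
      simp only [LinearMap.comp_apply, DirectSum.lof_eq_of]
      rw [DirectSum.one_def]
      rfl)
    (by
      intro i j a b
      simp only [LinearMap.comp_apply, DirectSum.lof_eq_of]
      rw [DirectSum.of_mul_of]
      rfl)).comp (DirectSum.decomposeAlgEquiv (forms V)).toAlgHom

lemma quotDecomposeAux_coe (n : ℕ) (a : forms V n) :
    quotDecomposeAux I a = DirectSum.of (fun n => quotForms I n) n (quotComponent I n a) := by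
  simp only [quotDecomposeAux, AlgHom.comp_apply]
  change DirectSum.toAlgebra _ _ _ _ _ (DirectSum.decompose (forms V) (a : CoordRing V)) = _
  rw [DirectSum.decompose_coe]
  exact DirectSum.toAddMonoid_of (fun i => (DirectSum.lof ℂ ℕ (fun n => quotForms I n) i ∘ₗ
    quotComponent I i).toAddMonoidHom) n a

lemma quotDecomposeAux_eq_zero (a : CoordRing V) (ha : a ∈ I.toIdeal) :
    quotDecomposeAux I a = 0 := by
  classical
  rw [← DirectSum.sum_support_decompose (forms V) a, map_sum]
  refine Finset.sum_eq_zero fun i _ => ?_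
  rw [quotDecomposeAux_coe]
  have h : quotComponent I i (DirectSum.decompose (forms V) a i) = 0 :=
    Subtype.ext (Ideal.Quotient.eq_zero_iff_mem.mpr (I.isHomogeneous i ha))
  rw [h, map_zero]

/-- The quotient of the coordinate ring by a homogeneous ideal is graded. -/
instance quotFormsGradedAlgebra : GradedAlgebra (quotForms I) :=
  GradedAlgebra.ofAlgHom _
    (Ideal.Quotient.liftₐ I.toIdeal (quotDecomposeAux I) (quotDecomposeAux_eq_zero I))
    (by
      apply Ideal.Quotient.algHom_ext
      apply SymmetricAlgebra.algHom_ext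
      ext l
      change DirectSum.coeAlgHom (quotForms I)
        (quotDecomposeAux I (SymmetricAlgebra.ι ℂ (Module.Dual ℂ V) l)) = _
      rw [show quotDecomposeAux I (SymmetricAlgebra.ι ℂ (Module.Dual ℂ V) l) = _ from
        quotDecomposeAux_coe I 1 ⟨_, ι_mem_forms V l⟩, DirectSum.coeAlgHom_of]
      rfl)
    (by
      rintro i ⟨_, a, ha, rfl⟩
      exact quotDecomposeAux_coe I i ⟨a, ha⟩)

/-- The closed subscheme `Proj (Sym (V^*) / I)` of `ℙ V` defined by a homogeneous ideal `I`. -/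
def projScheme : Scheme := Proj (quotForms I)

end Quotient

/-- The homogeneous ideal of a set `X` of points of `ℙ V`: it is generated by all forms that vanish
at every point of `X`. -/
def vanishingIdeal {V : Type*} [AddCommGroup V] [Module ℂ V] (X : Set (Projectivization ℂ V)) :
    HomogeneousIdeal (forms V) where
  toSubmodule := Ideal.span {F | (∃ n, F ∈ forms V n) ∧
    ∀ (v : V) (hv : v ≠ 0), Projectivization.mk ℂ v hv ∈ X → evalAt v F = 0}
  is_homogeneous' := Ideal.homogeneous_span _ _ fun _ hF => hF.1

/-- The Zariski closure in `ℙ V` of a set of points, with its reduced scheme structure. -/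
def zariskiClosure {V : Type*} [AddCommGroup V] [Module ℂ V] (X : Set (Projectivization ℂ V)) :
    Scheme :=
  projScheme (vanishingIdeal X)

/-- A scheme is nonsingular if all its local rings are regular. -/
def Nonsingular (X : Scheme) : Prop :=
  ∀ x : X, IsRegularLocalRing (X.presheaf.stalk x)

/-! ### Systems of quadrics -/

section System

variable {U W : Type*} [AddCommGroup U] [Module ℂ U] [AddCommGroup W] [Module ℂ W]
  (σ : (Sym[ℂ]^2 U) →ₗ[ℂ] W)

/-- The vector `σ(u, u)`. -/
def quad (u : U) : W := σ (SymmetricPower.tprod ℂ fun _ : Fin 2 => u)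

/-- The linear system of quadrics `W^* ⊆ Sym² U^*`: the quadratic forms `u ↦ l (σ(u, u))` on `U`,
for `l` a linear form on `W`. -/
def linearSystem : Set (CoordRing U) :=
  {F | F ∈ forms U 2 ∧ ∃ l : Module.Dual ℂ W, ∀ u : U, evalAt u F = l (quad σ u)}

/-- The homogeneous ideal generated by the linear system of quadrics. -/
def baseIdeal : HomogeneousIdeal (forms U) where
  toSubmodule := Ideal.span (linearSystem σ)
  is_homogeneous' := Ideal.homogeneous_span _ _ fun _ hF => ⟨2, hF.1⟩

/-- The scheme-theoretic base locus `B(σ) ⊆ ℙ U` of the linear system of quadrics. -/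
def B : Scheme := projScheme (baseIdeal σ)

/-- The set-theoretic image in `ℙ W` of the rational map `ψ° : ℙ U ⇢ ℙ W`, `[u] ↦ [σ(u, u)]`, on
the open set where `σ(u, u) ≠ 0`. -/
def psiImage : Set (Projectivization ℂ W) :=
  {y | ∃ (u : U) (h : quad σ u ≠ 0), y = Projectivization.mk ℂ (quad σ u) h}

/-- `Y(σ) ⊆ ℙ W`, the proper image of `ℙ U` under `ψ°`. -/
def Y : Scheme := zariskiClosure (psiImage σ)

/-- The vector `(t², t u, σ(u, u))` of `T ⊕ U ⊕ W`, where `T = ℂ`. -/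
def phiVec (t : ℂ) (u : U) : ℂ × U × W := (t ^ 2, t • u, quad σ u)

/-- The set-theoretic image in `ℙ (T ⊕ U ⊕ W)` of the rational map
`φ° : ℙ (T ⊕ U) ⇢ ℙ (T ⊕ U ⊕ W)`, `[t : u] ↦ [t² : t u : σ(u, u)]`, on the open set where the
right-hand side is nonzero. -/
def phiImage : Set (Projectivization ℂ (ℂ × U × W)) :=
  {z | ∃ (t : ℂ) (u : U) (h : phiVec σ t u ≠ 0), z = Projectivization.mk ℂ (phiVec σ t u) h}

/-- `Z(σ) ⊆ ℙ (T ⊕ U ⊕ W)`, the proper image of `ℙ (T ⊕ U)` under `φ°`. -/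
def Z : Scheme := zariskiClosure (phiImage σ)

/-- `σ : Sym² U → W` is a special system of quadrics; its base locus `B(σ) ⊆ ℙ U` is then a
special quadratic manifold. -/
structure IsSpecialSystem : Prop where
  surjective : Function.Surjective σ
  irreducible_base : IrreducibleSpace (B σ)
  nonsingular_base : Nonsingular (B σ)
  nonsingular_image : Nonsingular (Z σ)

end System

end QuadricSystem

end

/-! `Y(σ)` is a linear retract of `Z(σ)`: putting `t = 0` in `(t², tu, σ(u,u))` embeds `Y` in `Z`
through `ℙ W`, and forgetting the first two coordinates sends `Z` back to `Y`. Pulling back forms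
makes the homogeneous coordinate ring of `Y` a graded retract of that of `Z`, hence each local ring
`B` of `Y` a retract of a local ring `A` of `Z`. A retract `B = A/p` of a regular local ring is
regular (`IsRegularLocalRing.of_retract`): the splitting makes `m_A/m_A²` surject onto `p/m_A p ×
m_B/m_B²`, so with `μ` the minimal number of generators, `μ(m_B) + μ(p) ≤ μ(m_A) = dim A ≤ dim B +
μ(p)`, and `μ(p)` cancels. -/

/-! ### Retracts of regular local rings -/

namespace IsLocalRing

/-- The minimal number of generators of a module over a Noetherian local ring is the length of its
reduction modulo the maximal ideal. -/
lemma length_quotient_maximalIdeal_smul {R M : Type*} [CommRing R] [IsLocalRing R]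
    [AddCommGroup M] [Module R M] (N : Submodule R M) (fg : N.FG) :
    Module.length R (N ⧸ (maximalIdeal R • (⊤ : Submodule R N))) = N.spanFinrank := by
  let : Field (R ⧸ maximalIdeal R) := Ideal.Quotient.field _
  have : Module.Finite R N := Module.Finite.iff_fg.mpr fg
  have : Module.Finite (R ⧸ maximalIdeal R) (N ⧸ (maximalIdeal R • (⊤ : Submodule R N))) :=
    Module.Finite.of_restrictScalars_finite R _ _
  rw [spanFinrank_eq_finrank_quotient N fg]
  exact (Module.length_eq_of_surjective Ideal.Quotient.mk_surjective).trans
    (Module.length_eq_finrank (R ⧸ maximalIdeal R) _)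

end IsLocalRing

open IsLocalRing in
/-- A retract of a regular local ring is a regular local ring. -/
theorem IsRegularLocalRing.of_retract {A B : Type*} [CommRing A] [CommRing B]
    [IsRegularLocalRing A] [IsLocalRing B] (i : B →+* A) (r : A →+* B)
    (hri : ∀ b, r (i b) = b) : IsRegularLocalRing B := by
  have hr : Function.Surjective r := fun b => ⟨i b, hri b⟩
  have hi_loc : IsLocalHom i := ⟨fun b hb => by simpa [hri] using hb.map r⟩
  have hr_loc : IsLocalHom r := IsLocalHom.of_surjective r hr
  have : IsNoetherianRing B := isNoetherianRing_of_surjective A B r hr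
  set p := RingHom.ker r with hp
  have hpm : p ≤ maximalIdeal A := le_maximalIdeal (RingHom.ker_ne_top r)
  have hfgA : (maximalIdeal A).FG := (maximalIdeal A).fg_of_isNoetherianRing
  have hfgB : (maximalIdeal B).FG := (maximalIdeal B).fg_of_isNoetherianRing
  have hfgp : p.FG := p.fg_of_isNoetherianRing
  have hsub (a : A) : a - i (r a) ∈ p := by simp [hp, RingHom.mem_ker, hri]
  let : Algebra A B := r.toAlgebra
  have hsmul (a : A) (b : B) : a • b = r a * b := rfl
  let P := p ⧸ (maximalIdeal A • (⊤ : Submodule A p))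
  let C := maximalIdeal B ⧸ (maximalIdeal B • (⊤ : Submodule B (maximalIdeal B)))
  have hirm {a : A} (ha : a ∈ maximalIdeal A) : i (r a) ∈ maximalIdeal A :=
    map_nonunit i _ (map_nonunit r _ ha)
  -- The projection `a ↦ a - i (r a)` onto `p` is only additive. On `m_A` it becomes `A`-linear
  -- modulo `m_A p`: the defect is `i (r a) * (c - i (r c))`, with `i (r a) ∈ m_A`.
  let toP : maximalIdeal A →ₗ[A] P :=
    { toFun := fun a => Submodule.Quotient.mk ⟨a - i (r a), hsub a⟩
      map_add' := fun a b => by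
        rw [← Submodule.Quotient.mk_add]
        congr 1
        ext
        simp only [Submodule.coe_add, map_add]
        ring
      map_smul' := fun c a => by
        rw [RingHom.id_apply, ← Submodule.Quotient.mk_smul, Submodule.Quotient.eq]
        have : (⟨((c • a : maximalIdeal A) : A) - i (r (c • a : maximalIdeal A)), hsub _⟩ : p) -
            c • ⟨a - i (r a), hsub a⟩ = i (r a) • ⟨c - i (r c), hsub c⟩ := by
          ext
          simp only [Submodule.coe_sub, Submodule.coe_smul, smul_eq_mul, map_mul]
          ring
        rw [this]
        exact Submodule.smul_mem_smul (hirm a.2) trivial }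
  let toC : maximalIdeal A →ₗ[A] C :=
    { toFun := fun a => Submodule.Quotient.mk ⟨r a, map_nonunit r _ a.2⟩
      map_add' := fun a b => by
        rw [← Submodule.Quotient.mk_add]
        congr 1
        ext
        simp
      map_smul' := fun c a => by
        rw [RingHom.id_apply, ← Submodule.Quotient.mk_smul]
        congr 1
        ext
        simp [hsmul] }
  have hker : maximalIdeal A • (⊤ : Submodule A (maximalIdeal A)) ≤
      LinearMap.ker (toP.prod toC) := by
    rw [Submodule.smul_le]
    intro c hc a _
    rw [LinearMap.mem_ker, map_smul]
    refine Prod.ext ?_ ?_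
    · change c • (Submodule.Quotient.mk _ : P) = 0
      rw [← Submodule.Quotient.mk_smul, Submodule.Quotient.mk_eq_zero]
      exact Submodule.smul_mem_smul hc trivial
    · change c • (Submodule.Quotient.mk _ : C) = 0
      rw [← Submodule.Quotient.mk_smul, Submodule.Quotient.mk_eq_zero,
        ← algebraMap_smul B c]
      exact Submodule.smul_mem_smul (map_nonunit r _ hc) trivial
  -- The pair of classes of `x ∈ p` and `y ∈ m_B` comes from `x + i y`, since `r x = 0` and `r (i y)
  -- = y`.
  have hsurj : Function.Surjective (Submodule.liftQ _ (toP.prod toC) hker) := by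
    rintro ⟨x, y⟩
    obtain ⟨x, rfl⟩ := Submodule.Quotient.mk_surjective _ x
    obtain ⟨y, rfl⟩ := Submodule.Quotient.mk_surjective _ y
    have hrx : r x = 0 := x.2
    refine ⟨Submodule.Quotient.mk (⟨x, hpm x.2⟩ + ⟨i y, map_nonunit i _ y.2⟩), ?_⟩
    refine Prod.ext ?_ ?_
    · refine congrArg (Submodule.Quotient.mk (p := maximalIdeal A • (⊤ : Submodule A p))) ?_
      ext
      simp [hrx, hri]
    · refine congrArg (Submodule.Quotient.mk
        (p := maximalIdeal B • (⊤ : Submodule B (maximalIdeal B)))) ?_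
      ext
      simp [hrx, hri]
  have hlen := Module.length_le_of_surjective _ hsurj
  rw [Module.length_prod, length_quotient_maximalIdeal_smul _ hfgp,
    length_quotient_maximalIdeal_smul _ hfgA,
    Module.length_eq_of_surjective (S := A) (R := B) hr,
    length_quotient_maximalIdeal_smul _ hfgB] at hlen
  -- Dividing by `p` lowers the dimension by at most the number of generators of `p`.
  have hdim := ringKrullDim_le_ringKrullDim_quotient_add_spanFinrank p
    (hpm.trans_eq (ringJacobson_eq_maximalIdeal A).symm)
  rw [ringKrullDim_eq_of_ringEquiv (RingHom.quotientKerEquivOfSurjective hr),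
    ← IsRegularLocalRing.spanFinrank_maximalIdeal] at hdim
  refine .of_spanFinrank_maximalIdeal_le _ ?_
  have hlen' : (maximalIdeal B).spanFinrank + p.spanFinrank ≤ (maximalIdeal A).spanFinrank := by
    rw [add_comm]
    exact_mod_cast hlen
  have h : (((maximalIdeal B).spanFinrank + p.spanFinrank : ℕ) : WithBot ℕ∞) ≤
      ringKrullDim B + p.spanFinrank := le_trans (by exact_mod_cast hlen') hdim
  rw [Nat.cast_add] at h
  exact ENat.WithBot.add_le_add_natCast_right_iff.mp h

/-! ### Graded retracts and local rings of Proj -/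

namespace AlgebraicGeometry.Proj

open HomogeneousLocalization HomogeneousIdeal GradedFunLike

/-- If the graded ring `ℬ` is a retract of the graded ring `𝒜`, then the local rings of `Proj ℬ`
are retracts of local rings of `Proj 𝒜`; regularity is thus inherited by `Proj ℬ`. -/
theorem isRegularLocalRing_stalk_of_retract {A B σ τ : Type*} [CommRing A] [CommRing B]
    [SetLike σ A] [AddSubgroupClass σ A] [SetLike τ B] [AddSubgroupClass τ B]
    {𝒜 : ℕ → σ} {ℬ : ℕ → τ} [GradedRing 𝒜] [GradedRing ℬ] (i : ℬ →+*ᵍ 𝒜) (r : 𝒜 →+*ᵍ ℬ)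
    (hri : ∀ b, r (i b) = b)
    (h𝒜 : ∀ x : Proj 𝒜, IsRegularLocalRing ((Proj 𝒜).presheaf.stalk x)) (y : Proj ℬ) :
    IsRegularLocalRing ((Proj ℬ).presheaf.stalk y) := by
  -- This makes the contraction along `r` of any point of `Proj ℬ` a point of `Proj 𝒜`.
  have hirr : irrelevant ℬ ≤ (irrelevant 𝒜).map r := by
    rw [irrelevant_le]
    intro n hn b hb
    change b ∈ ((irrelevant 𝒜).map r).toIdeal
    rw [← hri b]
    exact Ideal.mem_map_of_mem r (mem_irrelevant_of_mem 𝒜 hn (map_mem i hb))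
  let x : Proj 𝒜 := ProjectiveSpectrum.comap r hirr y
  have := x.isPrime
  have := y.isPrime
  have : IsRegularLocalRing (AtPrime 𝒜 x.asHomogeneousIdeal.toIdeal) :=
    have := h𝒜 x
    .of_ringEquiv (stalkIso 𝒜 x).commRingCatIsoToRingEquiv
  have hx : x.asHomogeneousIdeal.toIdeal = y.asHomogeneousIdeal.toIdeal.comap r := rfl
  have hy : y.asHomogeneousIdeal.toIdeal = x.asHomogeneousIdeal.toIdeal.comap i := by
    ext b
    exact (congrArg (· ∈ y.asHomogeneousIdeal.toIdeal) (hri b)).to_iff.symm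
  have : IsRegularLocalRing (AtPrime ℬ y.asHomogeneousIdeal.toIdeal) := by
    refine .of_retract (localRingHom i _ _ hy) (localRingHom r _ _ hx) fun b => ?_
    obtain ⟨c, rfl⟩ := b.mk_surjective
    exact congrArg HomogeneousLocalization.mk (NumDenSameDeg.ext _ rfl (hri _) (hri _))
  exact .of_ringEquiv (R := AtPrime ℬ y.asHomogeneousIdeal.toIdeal)
    (stalkIso ℬ y).commRingCatIsoToRingEquiv.symm

end AlgebraicGeometry.Proj

/-! ### Pullback of forms and linear retracts -/

namespace QuadricSystem

section Pullback

variable {V V' : Type*} [AddCommGroup V] [Module ℂ V] [AddCommGroup V'] [Module ℂ V']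

/-- Pullback of polynomials along a linear map. -/
def pullback (f : V →ₗ[ℂ] V') : CoordRing V' →ₐ[ℂ] CoordRing V :=
  SymmetricAlgebra.lift (SymmetricAlgebra.ι ℂ (Module.Dual ℂ V) ∘ₗ f.dualMap)

lemma pullback_ι (f : V →ₗ[ℂ] V') (l : Module.Dual ℂ V') :
    pullback f (SymmetricAlgebra.ι ℂ _ l) = SymmetricAlgebra.ι ℂ _ (l ∘ₗ f) :=
  SymmetricAlgebra.lift_ι_apply ..

lemma pullback_mem_forms (f : V →ₗ[ℂ] V') {n : ℕ} {F : CoordRing V'} (hF : F ∈ forms V' n) :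
    pullback f F ∈ forms V n := by
  have h : (forms V' n).map (pullback f).toLinearMap ≤ forms V n := by
    rw [forms, forms, Submodule.map_pow]
    refine pow_le_pow_left' ?_ n
    rintro _ ⟨_, ⟨l, rfl⟩, rfl⟩
    exact ⟨l ∘ₗ f, (pullback_ι f l).symm⟩
  exact h ⟨F, hF, rfl⟩

lemma evalAt_pullback (f : V →ₗ[ℂ] V') (v : V) (F : CoordRing V') :
    evalAt v (pullback f F) = evalAt (f v) F := by
  have h : (evalAt v).comp (pullback f) = evalAt (f v) := by
    apply SymmetricAlgebra.algHom_ext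
    ext l
    simp [evalAt, pullback_ι]
  exact DFunLike.congr_fun h F

lemma pullback_pullback (f : V →ₗ[ℂ] V') (g : V' →ₗ[ℂ] V) (hfg : f ∘ₗ g = .id)
    (F : CoordRing V') : pullback g (pullback f F) = F := by
  have h : (pullback g).comp (pullback f) = .id ℂ (CoordRing V') := by
    apply SymmetricAlgebra.algHom_ext
    ext l
    simp [pullback_ι, LinearMap.comp_assoc, hfg]
  exact DFunLike.congr_fun h F

/-- The homomorphism of homogeneous coordinate rings induced by a linear map that sends the
subscheme defined by `I` into the subscheme defined by `I'`. -/
def quotPullback (f : V →ₗ[ℂ] V') (I : HomogeneousIdeal (forms V))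
    (I' : HomogeneousIdeal (forms V')) (h : I'.toIdeal ≤ I.toIdeal.comap (pullback f)) :
    quotForms I' →+*ᵍ quotForms I where
  __ := Ideal.quotientMap I.toIdeal (pullback f : CoordRing V' →+* CoordRing V) h
  map_mem := by
    rintro n _ ⟨F, hF, rfl⟩
    exact ⟨pullback f F, pullback_mem_forms f hF, rfl⟩

/-- A linear retract of a nonsingular closed subscheme of projective space is nonsingular. -/
theorem Nonsingular.of_retract {I : HomogeneousIdeal (forms V)} {I' : HomogeneousIdeal (forms V')}
    (f : V →ₗ[ℂ] V') (g : V' →ₗ[ℂ] V) (hfg : f ∘ₗ g = .id)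
    (hf : I'.toIdeal ≤ I.toIdeal.comap (pullback f))
    (hg : I.toIdeal ≤ I'.toIdeal.comap (pullback g)) (h : Nonsingular (projScheme I)) :
    Nonsingular (projScheme I') := by
  refine AlgebraicGeometry.Proj.isRegularLocalRing_stalk_of_retract (quotPullback f I I' hf)
    (quotPullback g I' I hg) (fun b => ?_) h
  obtain ⟨F, rfl⟩ := Ideal.Quotient.mk_surjective b
  exact congrArg (Ideal.Quotient.mk I'.toIdeal) (pullback_pullback f g hfg F)

/-- In degree zero `F` is constant; in positive degree it vanishes at the origin anyway. This
handles points in the centre of a projection, which map to the zero vector. -/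
lemma evalAt_zero_of_mem_forms {n : ℕ} {F : CoordRing V} (hF : F ∈ forms V n) (v : V)
    (hv : evalAt v F = 0) : evalAt 0 F = 0 := by
  have h : ∀ n, ∀ F ∈ forms V n, evalAt 0 F = 0 ∨ ∀ v, evalAt v F = evalAt 0 F := by
    intro n F hF
    rcases n with _ | n
    · right
      rw [forms, pow_zero] at hF
      obtain ⟨c, rfl⟩ := Submodule.mem_one.mp hF
      simp
    · left
      rw [forms, pow_succ] at hF
      refine Submodule.mul_induction_on hF ?_ fun a b ha hb => by rw [map_add, ha, hb, add_zero]
      rintro a - _ ⟨l, rfl⟩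
      simp [evalAt]
  exact (h n F hF).elim id fun h => (h v).symm.trans hv

end Pullback

section Vanishing

variable {V V' : Type*} [AddCommGroup V] [Module ℂ V] [AddCommGroup V'] [Module ℂ V']

lemma vanishingIdeal_eq_top_of_isEmpty {X : Set (Projectivization ℂ V)} (hX : X = ∅) :
    (vanishingIdeal X).toIdeal = ⊤ := by
  rw [Ideal.eq_top_iff_one]
  exact Ideal.subset_span ⟨⟨0, SetLike.GradedOne.one_mem⟩, by simp [hX]⟩

/-- Polynomials in the vanishing ideal of `X'` pull back to the vanishing ideal of `X` if the linear
map `f` sends `X` to `X'` where it is defined. -/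
lemma vanishingIdeal_le_comap_pullback (f : V →ₗ[ℂ] V') {X : Set (Projectivization ℂ V)}
    {X' : Set (Projectivization ℂ V')} (hX' : X'.Nonempty)
    (h : ∀ (v : V) (hv : v ≠ 0) (hfv : f v ≠ 0), Projectivization.mk ℂ v hv ∈ X →
      Projectivization.mk ℂ (f v) hfv ∈ X') :
    (vanishingIdeal X').toIdeal ≤ (vanishingIdeal X).toIdeal.comap (pullback f) := by
  refine Ideal.span_le.mpr ?_
  rintro F ⟨⟨n, hF⟩, hFX⟩
  refine Ideal.subset_span ⟨⟨n, pullback_mem_forms f hF⟩, fun v hv hvX => ?_⟩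
  rw [evalAt_pullback]
  by_cases hfv : f v = 0
  -- A point of `X'` is needed to exclude nonzero constants `F`.
  · obtain ⟨y, hy⟩ := hX'
    rw [hfv]
    exact evalAt_zero_of_mem_forms hF y.rep (hFX _ y.rep_nonzero (by rwa [y.mk_rep]))
  · exact hFX _ hfv (h v hv hfv hvX)

end Vanishing

lemma nonsingular_projScheme_of_eq_top {V : Type*} [AddCommGroup V] [Module ℂ V]
    {I : HomogeneousIdeal (forms V)} (hI : I.toIdeal = ⊤) : Nonsingular (projScheme I) := by
  intro (x : ProjectiveSpectrum (quotForms I))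
  have : Subsingleton (CoordRing V ⧸ I.toIdeal) := Ideal.Quotient.subsingleton_iff.mpr hI
  exact absurd (Subsingleton.elim _ _) x.isPrime.ne_top

/-- `Y(σ)` is a linear retract of `Z(σ)`: it is the intersection of `Z(σ)` with `ℙ W`, and the
projection `ℙ (T ⊕ U ⊕ W) ⇢ ℙ W` sends `Z(σ)` to `Y(σ)`. -/
theorem nonsingular_Y {U W : Type*} [AddCommGroup U] [Module ℂ U] [AddCommGroup W] [Module ℂ W]
    (σ : (Sym[ℂ]^2 U) →ₗ[ℂ] W) (hZ : Nonsingular (Z σ)) : Nonsingular (Y σ) := by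
  -- If `σ(u,u)` is always zero, then `1` lies in the ideal of `Y`, so pullback along the projection
  -- would not respect the ideals; but then `Y` is the empty scheme.
  rcases (psiImage σ).eq_empty_or_nonempty with hY | ⟨y, hy⟩
  · exact nonsingular_projScheme_of_eq_top (vanishingIdeal_eq_top_of_isEmpty hY)
  let f : ℂ × U × W →ₗ[ℂ] W := LinearMap.snd ℂ U W ∘ₗ LinearMap.snd ℂ ℂ (U × W)
  let g : W →ₗ[ℂ] ℂ × U × W := LinearMap.inr ℂ ℂ (U × W) ∘ₗ LinearMap.inr ℂ U W
  have hg (w : W) (hw : w ≠ 0) (hgw : g w ≠ 0) (hwY : Projectivization.mk ℂ w hw ∈ psiImage σ) :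
      Projectivization.mk ℂ (g w) hgw ∈ phiImage σ := by
    obtain ⟨u, hu, h⟩ := hwY
    obtain ⟨c, rfl⟩ := (Projectivization.mk_eq_mk_iff ℂ _ _ hw hu).mp h
    have hgu : g (quad σ u) = phiVec σ 0 u := by simp [g, phiVec]
    refine ⟨0, u, fun h0 => hu (congrArg f h0), ?_⟩
    exact (Projectivization.mk_eq_mk_iff ℂ _ _ _ _).mpr ⟨c, by
      rw [← hgu]
      exact (map_smul g (c : ℂ) _).symm⟩
  have hf (v : ℂ × U × W) (hv : v ≠ 0) (hfv : f v ≠ 0)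
      (hvZ : Projectivization.mk ℂ v hv ∈ phiImage σ) :
      Projectivization.mk ℂ (f v) hfv ∈ psiImage σ := by
    obtain ⟨t, u, hu, h⟩ := hvZ
    obtain ⟨c, rfl⟩ := (Projectivization.mk_eq_mk_iff ℂ _ _ hv hu).mp h
    exact ⟨u, fun h0 => hfv (by change c • quad σ u = 0; rw [h0, smul_zero]),
      (Projectivization.mk_eq_mk_iff ℂ _ _ _ _).mpr ⟨c, rfl⟩⟩
  obtain ⟨u, hu, -⟩ := id hy
  have hZne : (phiImage σ).Nonempty :=
    ⟨_, 0, u, fun h0 => hu (congrArg f h0), rfl⟩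
  exact Nonsingular.of_retract f g rfl (vanishingIdeal_le_comap_pullback f ⟨y, hy⟩ hf)
    (vanishingIdeal_le_comap_pullback g hZne hg) hZ

end QuadricSystem

theorem proposition3p1 {U W : Type*} [AddCommGroup U] [Module ℂ U] [FiniteDimensional ℂ U]
    [AddCommGroup W] [Module ℂ W] [FiniteDimensional ℂ W]
    (σ : (Sym[ℂ]^2 U) →ₗ[ℂ] W) (hσ : QuadricSystem.IsSpecialSystem σ) :
    QuadricSystem.Nonsingular (QuadricSystem.Y σ) :=
  QuadricSystem.nonsingular_Y σ hσ.nonsingular_image
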